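/- **Theorem (MongoRaftReconfig satisfies Leader Completeness).** Let $Server$ be a finite set of servers. A state assigns to every server $s$ a log $log[s]$ (a finite sequence of natural numbers, the terms of its entries, indexed from $1$), a current term $term[s]\in\mathbb N$, a role $state[s]\in\{Primary,Secondary\}$, and a configuration consisting of a member set $config[s]\subseteq Server$, a version $configVersion[s]\in\mathbb N$ and a term $configTerm[s]\in\mathbb N$; moreover it has a set $committed\subseteq\mathbb N\times\mathbb N$ of (index, term) pairs. *Notation.* $Quorums(m)$ is the set of $Q\subseteq m$ with $2|Q|>|m|$. $InLog(i,t,s)$ means that $1\le i\le |log[s]|$ and $log[s][i]=t$. $lastTerm(s)$ is the last element of $log[s]$, or $0$ if $log[s]$ is empty. Configurations are compared by configuration term first, then by version, and count as the same if both agree. *Initial states* ($MRRInit$). All logs are empty, $committed=\emptyset$, all servers are secondaries with $term=0$, and all have the same non-empty member set, with $configVersion=1$ and $configTerm=0$. *Steps* ($MRRNext$). For some servers $s,t$ and some $Q\in Quorums(config[s])$, one of the following happens, and all variables not mentioned are unchanged. 1. $ClientRequest(s)$: $s$ is primary and appends $term[s]$ to its log. 2. $GetEntries(s,t)$: $s$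 is secondary, $|log[t]|>|log[s]|$, and $log[s]$ is empty or its last entry equals the entry of $log[t]$ at the same index; $s$ appends the entry of $log[t]$ at index $|log[s]|+1$. 3. $RollbackEntries(s,t)$: $s$ is secondary with a non-empty log, $lastTerm(s)<lastTerm(t)$, and the last entry of $log[s]$ is not in $log[t]$, that is, not $InLog(|log[s]|,lastTerm(s),t)$; $s$ deletes its last entry. 4. $CommitEntry(s,Q)$: $s$ is primary with a non-empty log, $lastTerm(s)=term[s]$, and every $v\in Q$ satisfies $InLog(|log[s]|,term[s],v)$ and $term[v]=term[s]$; the pair $(|log[s]|,term[s])$ is added to $committed$. 5. $SendConfig(s,t)$: $t$ is secondary and the configuration of $s$ is newer than that of $t$; $t$ takes over the member set, version and configuration term of $s$. 6. $Reconfig(s,m)$ for some $m\subseteq Server$: $s$ is primary; the servers of some quorum of $config[s]$ all have the same configuration version and term as $s$; the servers of some quorum of $config[s]$ all have the term of $s$; for every $(i,t')\in committed$ there is a quorum of $config[s]$ all of whose servers $v$ satisfy $InLog(i,t',v)$; every quorum of $config[s]$ intersects every quorum of $m$; and $s\in m$. Then $config[s]$ becomes $m$, $configVersion[s]$ increases by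 $1$, and $configTerm[s]$ becomes $term[s]$. 7. $BecomeLeader(s,Q)$: $s\in config[s]$, $s\in Q$, and for every $v\in Q$: $term[v]<term[s]+1$; the configuration of $s$ is newer than or the same as that of $v$; and either $lastTerm(s)>lastTerm(v)$, or $lastTerm(s)=lastTerm(v)$ and $|log[s]|\ge|log[v]|$. Let $T=term[s]+1$. Then all servers in $Q$ get term $T$, $s$ becomes primary, the other servers in $Q$ become secondaries, and $configTerm[s]$ becomes $T$. 8. $UpdateTerms(s,t)$: $term[s]>term[t]$; $t$ gets the term of $s$ and becomes secondary. Let $MRRSpec = MRRInit\wedge\square[MRRNext]_{vars}$: an infinite sequence of states satisfies it if its first state is initial and each step is an $MRRNext$ step or leaves the state unchanged. Let $LeaderCompleteness$ be the state predicate $$\forall s\in Server,\ \forall (cindex,cterm)\in committed:\ (state[s]=Primary\wedge cterm<term[s])\Rightarrow InLog(cindex,cterm,s).$$ Then $$MRRSpec\Rightarrow\square LeaderCompleteness$$ is valid: in every state of every behavior satisfying $MRRSpec$ (hence in every reachable state), each committed entry whose term is less than the term of a primary server $s$ is present in the log of $s$. -/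

import Mathlib

namespace MRR

/-! ### Temporal formulas over infinite behaviors -/

/-- A behavior is an infinite sequence of states. -/
abbrev Behavior (S : Type*) := ℕ → S

/-- A temporal formula is a predicate on behaviors. -/
abbrev TemporalFormula (S : Type*) := Behavior S → Prop

/-- A state predicate, read as a temporal formula: it holds in the first state. -/
def StateFormula {S : Type*} (P : S → Prop) : TemporalFormula S :=
  fun σ => P (σ 0)

/-- `[A]_vars`: the first step is an `A`-step, or it leaves all variables unchanged. -/
def StepFormula {S : Type*} (A : S → S → Prop) : TemporalFormula S :=
  fun σ => A (σ 0) (σ 1) ∨ σ 1 = σ 0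

/-- The operator `□` (always): the formula holds on every suffix of the behavior. -/
def Always {S : Type*} (F : TemporalFormula S) : TemporalFormula S :=
  fun σ => ∀ n : ℕ, F (fun k => σ (n + k))

/-- Validity: a formula is valid if it is true of every behavior. -/
def Valid {S : Type*} (F : TemporalFormula S) : Prop :=
  ∀ σ : Behavior S, F σ

/-! ### States -/

inductive Role where
  | primary : Role
  | secondary : Role

/-- The state variables. A log is the sequence of the terms of its entries; `committed` is a set of
pairs (index, term); the configuration of a server is its member set together with a version and
a term. -/
@[ext]
structure State (Server : Type*) where
  log : Server → List ℕ
  committed : Set (ℕ × ℕ)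
  term : Server → ℕ
  state : Server → Role
  config : Server → Finset Server
  configVersion : Server → ℕ
  configTerm : Server → ℕ

variable {Server : Type*} [DecidableEq Server]

/-! ### Quorums, logs, configurations -/

/-- `Q` is a majority quorum of the member set `m`. -/
def IsQuorum (m Q : Finset Server) : Prop :=
  Q ⊆ m ∧ m.card < 2 * Q.card

/-- Every quorum of `m₁` meets every quorum of `m₂`. -/
def QuorumsOverlap (m₁ m₂ : Finset Server) : Prop :=
  ∀ Q₁ Q₂ : Finset Server, IsQuorum m₁ Q₁ → IsQuorum m₂ Q₂ → (Q₁ ∩ Q₂).Nonempty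

/-- The entry at position `i` of the log `l` has term `t`. Positions are counted from 1. -/
def HasEntry (l : List ℕ) (i t : ℕ) : Prop :=
  1 ≤ i ∧ l[i - 1]? = some t

/-- The term of the last entry of a log, or 0 if the log is empty. -/
def lastTerm (l : List ℕ) : ℕ :=
  l.getLast?.getD 0

/-- The entry with index `i` and term `t` is in the log of server `s`. -/
def InLog (x : State Server) (i t : ℕ) (s : Server) : Prop :=
  HasEntry (x.log s) i t

/-- The configuration of `s` is newer than that of `t`: terms are compared first, then versions. -/
def IsNewerConfig (x : State Server) (s t : Server) : Prop :=
  x.configTerm t < x.configTerm s ∨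
    (x.configTerm s = x.configTerm t ∧ x.configVersion t < x.configVersion s)

/-- The configurations of `s` and `t` have the same version and term. -/
def SameConfig (x : State Server) (s t : Server) : Prop :=
  x.configTerm s = x.configTerm t ∧ x.configVersion s = x.configVersion t

/-- All servers of `Q` have the entry `(i, t)` and are in term `t`. -/
def ImmediatelyCommitted (x : State Server) (i t : ℕ) (Q : Finset Server) : Prop :=
  ∀ v ∈ Q, InLog x i t v ∧ x.term v = t

/-! ### Actions on logs -/

/-- The primary `s` appends an entry with its current term to its log. -/
def ClientRequest (s : Server) (x y : State Server) : Prop :=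
  x.state s = Role.primary ∧
  y = { x with log := Function.update x.log s (x.log s ++ [x.term s]) }

/-- The secondary `s` appends to its log the next entry of the log of `t`, provided that the last
entry of its log (if any) agrees with the entry of `t` at that index. -/
def GetEntries (s t : Server) (x y : State Server) : Prop :=
  x.state s = Role.secondary ∧
  (x.log s ≠ [] → InLog x (x.log s).length (lastTerm (x.log s)) t) ∧
  ∃ e : ℕ, InLog x ((x.log s).length + 1) e t ∧
    y = { x with log := Function.update x.log s (x.log s ++ [e]) }

/-- The last term of the log of `s` is smaller than that of `t`, and the last entry of `s` is not in
the log of `t`. -/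
def CanRollback (x : State Server) (s t : Server) : Prop :=
  x.log s ≠ [] ∧
  lastTerm (x.log s) < lastTerm (x.log t) ∧
  ¬ InLog x (x.log s).length (lastTerm (x.log s)) t

/-- The secondary `s` removes the last entry of its log, which has diverged from that of `t`. -/
def RollbackEntries (s t : Server) (x y : State Server) : Prop :=
  x.state s = Role.secondary ∧
  CanRollback x s t ∧
  y = { x with log := Function.update x.log s (x.log s).dropLast }

/-- The primary `s` commits the last entry of its log, which it wrote in its current term and which
is present on all servers of `Q`, all of them in that term. -/
def CommitEntry (s : Server) (Q : Finset Server) (x y : State Server) : Prop :=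
  x.state s = Role.primary ∧
  x.log s ≠ [] ∧
  lastTerm (x.log s) = x.term s ∧
  ImmediatelyCommitted x (x.log s).length (x.term s) Q ∧
  y = { x with committed := insert ((x.log s).length, x.term s) x.committed }

/-! ### Actions on configurations -/

/-- The server `s` sends its configuration to the secondary `t`, which installs it if it is newer
than its own. -/
def SendConfig (s t : Server) (x y : State Server) : Prop :=
  x.state t = Role.secondary ∧
  IsNewerConfig x s t ∧
  y = { x with
    config := Function.update x.config t (x.config s)
    configVersion := Function.update x.configVersion t (x.configVersion s)
    configTerm := Function.update x.configTerm t (x.configTerm s) }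

/-- A quorum of the configuration of `s` has this configuration. -/
def ConfigQuorumCheck (x : State Server) (s : Server) : Prop :=
  ∃ Q : Finset Server, IsQuorum (x.config s) Q ∧ ∀ v ∈ Q, SameConfig x v s

/-- A quorum of the configuration of `s` is in the term of `s`. -/
def TermQuorumCheck (x : State Server) (s : Server) : Prop :=
  ∃ Q : Finset Server, IsQuorum (x.config s) Q ∧ ∀ v ∈ Q, x.term v = x.term s

/-- Each committed entry is in the logs of a quorum of the configuration of `s`. -/
def OplogCommitment (x : State Server) (s : Server) : Prop :=
  ∀ c ∈ x.committed, ∃ Q : Finset Server, IsQuorum (x.config s) Q ∧ ∀ v ∈ Q, InLog x c.1 c.2 v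

/-- The primary `s` moves to a new configuration with member set `m`. -/
def Reconfig (s : Server) (m : Finset Server) (x y : State Server) : Prop :=
  x.state s = Role.primary ∧
  ConfigQuorumCheck x s ∧
  TermQuorumCheck x s ∧
  OplogCommitment x s ∧
  QuorumsOverlap (x.config s) m ∧
  s ∈ m ∧
  y = { x with
    config := Function.update x.config s m
    configVersion := Function.update x.configVersion s (x.configVersion s + 1)
    configTerm := Function.update x.configTerm s (x.term s) }

/-! ### Elections and terms -/

/-- `v` can vote for `s` in term `T`, as far as the configurations are concerned. -/
def CanVoteForConfig (x : State Server) (v s : Server) (T : ℕ) : Prop :=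
  x.term v < T ∧ (IsNewerConfig x s v ∨ SameConfig x s v)

/-- `v` can vote for `s` in term `T`, as far as the logs are concerned. -/
def CanVoteForOplog (x : State Server) (v s : Server) (T : ℕ) : Prop :=
  x.term v < T ∧
  (lastTerm (x.log v) < lastTerm (x.log s) ∨
    (lastTerm (x.log s) = lastTerm (x.log v) ∧ (x.log v).length ≤ (x.log s).length))


/-- The server `s` is elected primary in a new term by the voters `Q`. The voters move to the new
term, all of them except `s` become secondaries, and the configuration of `s` gets the new term. -/
def BecomeLeader (s : Server) (Q : Finset Server) (x y : State Server) : Prop :=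
  s ∈ x.config s ∧
  s ∈ Q ∧
  (∀ v ∈ Q, CanVoteForConfig x v s (x.term s + 1) ∧ CanVoteForOplog x v s (x.term s + 1)) ∧
  y = { x with
    term := fun v => if v ∈ Q then x.term s + 1 else x.term v
    state := fun v =>
      if v = s then Role.primary else if v ∈ Q then Role.secondary else x.state v
    configTerm := Function.update x.configTerm s (x.term s + 1) }

/-- The newer term of `s` is propagated to `t`, which becomes a secondary. -/
def UpdateTerms (s t : Server) (x y : State Server) : Prop :=
  x.term t < x.term s ∧
  y = { x with
    term := Function.update x.term t (x.term s)
    state := Function.update x.state t Role.secondary }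

/-! ### The specification and the property -/

/-- Initially all logs are empty, nothing is committed, all servers are secondaries in term 0, and
they share one non-empty configuration, of version 1 and term 0. -/
def MRRInit (x : State Server) : Prop :=
  (∀ s, x.log s = []) ∧
  x.committed = ∅ ∧
  (∀ s, x.term s = 0) ∧
  (∀ s, x.state s = Role.secondary) ∧
  (∃ m : Finset Server, m.Nonempty ∧ ∀ s, x.config s = m) ∧
  (∀ s, x.configVersion s = 1) ∧
  (∀ s, x.configTerm s = 0)

/-- The next state relation. -/
def MRRNext (x y : State Server) : Prop :=
  ∃ s t : Server, ∃ Q : Finset Server, IsQuorum (x.config s) Q ∧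
    (ClientRequest s x y ∨
     GetEntries s t x y ∨
     RollbackEntries s t x y ∨
     CommitEntry s Q x y ∨
     SendConfig s t x y ∨
     (∃ m : Finset Server, Reconfig s m x y) ∨
     BecomeLeader s Q x y ∨
     UpdateTerms s t x y)

/-- `MRRInit ∧ □[MRRNext]_vars` -/
def MRRSpec : TemporalFormula (State Server) :=
  fun σ => StateFormula MRRInit σ ∧ Always (StepFormula MRRNext) σ

/-- Each committed entry whose term is less than the term of a primary is in the primary's log. -/
def LeaderCompleteness (x : State Server) : Prop :=
  ∀ s : Server, ∀ cindex cterm : ℕ, (cindex, cterm) ∈ x.committed →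
    (x.state s = Role.primary ∧ cterm < x.term s) → InLog x cindex cterm s

end MRR

/-!
Every reachable state satisfies an inductive invariant, in two parts. Its clause
`LogInv.primary_committed` is slightly stronger than Leader Completeness.

`ConfigInv` concerns terms and configurations. A configuration is `Active` if some quorum of its
members has nothing newer; an election needs an active configuration. Active configurations have
pairwise overlapping quorums, and every quorum of an active one contains a server whose term is at
least that of any given configuration. Hence a server is elected in a term larger than every
configuration term (`ConfigInv.configTerm_lt`), which gives unique primaries and keeps
configurations identified by version and term. A primary that has a quorum in its own term has a
newest configuration (`ConfigInv.not_newer`), so that a reconfiguration, whose configuration check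
deactivates all older configurations (`ConfigInv.active_reconfig`), preserves the overlap.

`LogInv` concerns logs. Besides the log matching properties it says that a committed entry is in
every log with an entry of a larger term, and in some log of every quorum of every active
configuration. Commits preserve this, since the committing primary has a newest configuration, and
reconfigurations do because they wait until the committed entries are on a quorum. A newly elected
primary then has, among its voters, one with the committed entry, and the comparison of logs in the
vote transfers the entry to the primary (`LogInv.inLog_of_vote`). A secondary only ever replaces its
log by an initial segment of some log, and a rollback does not delete a committed entry, because the
log of the later term that causes it would contain the entry as well.
-/

namespace MRR

variable {Server : Type*}

/-! ### Entries of logs -/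

theorem HasEntry.length_le {l : List ℕ} {i e : ℕ} (h : HasEntry l i e) : i ≤ l.length := by
  obtain ⟨h1, h2⟩ := h
  have := (List.getElem?_eq_some_iff.1 h2).1
  omega

theorem HasEntry.unique {l : List ℕ} {i e f : ℕ} (h : HasEntry l i e) (h' : HasEntry l i f) :
    e = f := by
  have := h.2.symm.trans h'.2
  simpa using this

theorem not_hasEntry_nil (i e : ℕ) : ¬ HasEntry [] i e := by
  simp [HasEntry]

theorem hasEntry_lastTerm {l : List ℕ} (h : l ≠ []) : HasEntry l l.length (lastTerm l) := by
  have := List.length_pos_iff.2 h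
  refine ⟨by omega, ?_⟩
  rw [← List.getLast?_eq_getElem?, lastTerm, List.getLast?_eq_some_getLast h]
  rfl

theorem hasEntry_append_singleton {l : List ℕ} {a i e : ℕ} :
    HasEntry (l ++ [a]) i e ↔ HasEntry l i e ∨ (i = l.length + 1 ∧ e = a) := by
  unfold HasEntry
  rcases lt_trichotomy (i - 1) l.length with h | h | h
  · rw [List.getElem?_append_left h]
    grind
  · rw [h, List.getElem?_append_right le_rfl]
    grind
  · rw [List.getElem?_append_right h.le]
    grind

theorem hasEntry_dropLast {l : List ℕ} {i e : ℕ} :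
    HasEntry l.dropLast i e ↔ HasEntry l i e ∧ i ≤ l.length - 1 := by
  unfold HasEntry
  rw [List.getElem?_dropLast]
  grind

/-! ### Active configurations -/

/-- The configuration of `s` is active: some quorum of its member set consists of servers none of
which has a newer configuration. Only an active configuration can still win an election. -/
def Active (x : State Server) (s : Server) : Prop :=
  ∃ Q, IsQuorum (x.config s) Q ∧ ∀ n ∈ Q, ¬ IsNewerConfig x n s

theorem Active.of_newer {x y : State Server} {u u' : Server} (h : Active y u)
    (hc : y.config u = x.config u')
    (hn : ∀ n, IsNewerConfig x n u' → IsNewerConfig y n u) : Active x u' := by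
  obtain ⟨Q, hQ, hQn⟩ := h
  exact ⟨Q, hc ▸ hQ, fun n hn' hx => hQn n hn' (hn n hx)⟩

/-! ### The invariant on logs -/

/-- The inductive invariant on logs and committed entries. -/
structure LogInv (x : State Server) : Prop where
  matching : ∀ s t i j e f, InLog x i e s → InLog x i e t → j ≤ i → InLog x j f s → InLog x j f t
  sorted : ∀ s i j e f, InLog x i e s → InLog x j f s → i ≤ j → e ≤ f
  /-- For sorted logs this says that the entries of a given term start at the same index in all logs
  that have any. -/
  uniform : ∀ s t i k e, InLog x i e s → InLog x k e t → i ≤ k → InLog x i e t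
  primary_has : ∀ p s i, x.state p = Role.primary → InLog x i (x.term p) s →
    InLog x i (x.term p) p
  primary_bound : ∀ p i e, x.state p = Role.primary → InLog x i e p → e ≤ x.term p
  exists_configTerm : ∀ s i e, InLog x i e s → ∃ t, e ≤ x.configTerm t
  primary_committed : ∀ s i e, x.state s = Role.primary → (i, e) ∈ x.committed → e ≤ x.term s →
    InLog x i e s
  later_committed : ∀ s i j e f, (i, e) ∈ x.committed → InLog x j f s → e < f → InLog x i e s
  active_committed : ∀ s i e Q, (i, e) ∈ x.committed → Active x s → IsQuorum (x.config s) Q →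
    ∃ n ∈ Q, InLog x i e n

theorem LogInv.of_init {x : State Server} (h : MRRInit x) : LogInv x := by
  obtain ⟨hl, hc, -⟩ := h
  have h0 : ∀ i e s, ¬ InLog x i e s := fun i e s h => not_hasEntry_nil i e (hl s ▸ h)
  constructor <;> simp [h0, hc]

/-- A log at least as recent as one with a committed entry has this entry, too. -/
theorem LogInv.inLog_of_vote {x : State Server} (h : LogInv x) {n s : Server} {i e T : ℕ}
    (hie : (i, e) ∈ x.committed) (hn : InLog x i e n) (hvote : CanVoteForOplog x n s T) :
    InLog x i e s := by
  have hnnil : x.log n ≠ [] := fun h0 => not_hasEntry_nil i e (h0 ▸ hn)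
  have hlastn : InLog x _ _ n := hasEntry_lastTerm hnnil
  have hle : e ≤ lastTerm (x.log n) := h.sorted n _ _ _ _ hn hlastn hn.length_le
  rcases hvote.2 with hlt | ⟨heq, hlen⟩
  · have hsnil : x.log s ≠ [] := fun h0 => by simp [h0, lastTerm] at hlt
    exact h.later_committed s i _ e _ hie (hasEntry_lastTerm hsnil) (hle.trans_lt hlt)
  · have hsnil : x.log s ≠ [] := by
      have := List.length_pos_iff.2 hnnil
      exact List.length_pos_iff.1 (this.trans_le hlen)
    have hlasts : InLog x _ _ s := hasEntry_lastTerm hsnil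
    rcases hle.lt_or_eq with hlt | heq'
    · exact h.later_committed s i _ e _ hie hlasts (heq ▸ hlt)
    · rw [heq, ← heq'] at hlasts
      exact h.uniform n s i _ e hn hlasts (hn.length_le.trans hlen)

/-! ### Quorums -/

variable [DecidableEq Server]

theorem quorumsOverlap_self (m : Finset Server) : QuorumsOverlap m m := by
  intro Q₁ Q₂ h₁ h₂
  by_contra h
  rw [Finset.not_nonempty_iff_eq_empty] at h
  have h3 := Finset.card_union_add_card_inter Q₁ Q₂
  have h4 := Finset.card_le_card (Finset.union_subset h₁.1 h₂.1)
  have := h₁.2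
  have := h₂.2
  rw [h, Finset.card_empty] at h3
  omega

theorem QuorumsOverlap.exists_mem {m₁ m₂ Q₁ Q₂ : Finset Server} (h : QuorumsOverlap m₁ m₂)
    (h₁ : IsQuorum m₁ Q₁) (h₂ : IsQuorum m₂ Q₂) : ∃ n, n ∈ Q₁ ∧ n ∈ Q₂ := by
  obtain ⟨n, hn⟩ := h Q₁ Q₂ h₁ h₂
  exact ⟨n, Finset.mem_inter.1 hn⟩

/-! ### The invariant on configurations -/

/-- The inductive invariant on terms, roles and configurations. -/
structure ConfigInv (x : State Server) : Prop where
  primary_unique : ∀ s t, x.state s = Role.primary → x.state t = Role.primary →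
    x.term s = x.term t → s = t
  primary_configTerm : ∀ s, x.state s = Role.primary → x.configTerm s = x.term s
  config_eq : ∀ s t, SameConfig x s t → x.config s = x.config t
  primary_newest : ∀ p s, x.state p = Role.primary → x.configTerm s = x.configTerm p →
    x.configVersion s ≤ x.configVersion p
  active_overlap : ∀ s t, Active x s → Active x t → QuorumsOverlap (x.config s) (x.config t)
  /-- No active configuration can win an election in a term at most that of any configuration. -/
  active_safe : ∀ s t Q, Active x t → IsQuorum (x.config t) Q → ∃ n ∈ Q, x.configTerm s ≤ x.term n
  /-- A configuration of a larger term keeps a primary from committing and reconfiguring. -/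
  stale_blocked : ∀ p s Q, x.state p = Role.primary → x.term p < x.configTerm s →
    IsQuorum (x.config p) Q → ∃ n ∈ Q, x.term p < x.term n

theorem ConfigInv.of_init {x : State Server} (h : MRRInit x) : ConfigInv x := by
  obtain ⟨-, -, ht, hs, ⟨m, -, hm⟩, hv, hc⟩ := h
  refine ⟨?_, ?_, ?_, ?_, ?_, ?_, ?_⟩
  · simp [hs]
  · simp [hs]
  · simp [hm]
  · simp [hs]
  · intro s t _ _
    rw [hm, hm]
    exact quorumsOverlap_self m
  · intro s t Q _ hQ
    obtain ⟨n, hn, -⟩ := (quorumsOverlap_self _).exists_mem hQ hQ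
    exact ⟨n, hn, by simp [hc]⟩
  · simp [hs]

/-! ### Preservation of the invariant on configurations -/

theorem ConfigInv.set_log_committed {x : State Server} (h : ConfigInv x) (l : Server → List ℕ)
    (c : Set (ℕ × ℕ)) : ConfigInv { x with log := l, committed := c } :=
  ⟨h.primary_unique, h.primary_configTerm, h.config_eq, h.primary_newest, h.active_overlap,
    h.active_safe, h.stale_blocked⟩

/-- The step `SendConfig` creates no new active member sets. -/
theorem SendConfig.active {s t : Server} {x y : State Server} (h : SendConfig s t x y)
    {u : Server} (hu : Active y u) : ∃ u', Active x u' ∧ y.config u = x.config u' := by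
  obtain ⟨-, hnew, rfl⟩ := h
  by_cases hut : u = t
  · subst hut
    refine ⟨s, hu.of_newer (by simp) ?_, by simp⟩
    intro n hn
    by_cases hnu : n = u <;> grind [IsNewerConfig]
  · refine ⟨u, hu.of_newer (by simp [hut]) ?_, by simp [hut]⟩
    intro n hn
    by_cases hnt : n = t <;> grind [IsNewerConfig]

theorem ConfigInv.sendConfig {s t : Server} {x y : State Server} (h : ConfigInv x)
    (hxy : SendConfig s t x y) : ConfigInv y := by
  have hact := @hxy.active
  obtain ⟨hsec, hnew, rfl⟩ := hxy
  have hcfg : ∀ u, ∃ u', x.configTerm u' = Function.update x.configTerm t (x.configTerm s) u := by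
    intro u
    by_cases hut : u = t
    · exact ⟨s, by simp [hut]⟩
    · exact ⟨u, by simp [hut]⟩
  have hpt : ∀ p, x.state p = Role.primary → p ≠ t := by
    rintro p hp rfl
    simp [hsec] at hp
  refine ⟨h.primary_unique, ?_, ?_, ?_, ?_, ?_, ?_⟩
  · intro p hp
    simpa [hpt p hp] using h.primary_configTerm p hp
  · have := h.config_eq
    intro a b hab
    by_cases ha : a = t <;> by_cases hb : b = t <;> grind [SameConfig]
  · intro p a hp
    have h1 := h.primary_newest p a hp
    have h2 := h.primary_newest p s hp
    have := hpt p hp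
    by_cases ha : a = t <;> grind
  · intro a b ha hb
    obtain ⟨a', ha', hea⟩ := hact ha
    obtain ⟨b', hb', heb⟩ := hact hb
    rw [hea, heb]
    exact h.active_overlap a' b' ha' hb'
  · intro a b Q hb hQ
    obtain ⟨b', hb', heb⟩ := hact hb
    obtain ⟨a', ha'⟩ := hcfg a
    have := h.active_safe a' b' Q hb' (heb ▸ hQ)
    simpa [ha'] using this
  · intro p a Q hp hpa hQ
    obtain ⟨a', ha'⟩ := hcfg a
    have := hpt p hp
    refine h.stale_blocked p a' Q hp (by simpa [ha'] using hpa) ?_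
    simpa [this] using hQ

theorem ConfigInv.updateTerms {s t : Server} {x y : State Server} (h : ConfigInv x)
    (hxy : UpdateTerms s t x y) : ConfigInv y := by
  obtain ⟨hlt, rfl⟩ := hxy
  have hp : ∀ p, Function.update x.state t Role.secondary p = Role.primary →
      x.state p = Role.primary ∧ p ≠ t := by
    intro p hp
    by_cases hpt : p = t
    · simp [hpt] at hp
    · exact ⟨by simpa [hpt] using hp, hpt⟩
  have hle : ∀ n, x.term n ≤ Function.update x.term t (x.term s) n := by
    intro n
    by_cases hn : n = t
    · subst hn
      simpa using hlt.le
    · simp [hn]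
  refine ⟨?_, ?_, h.config_eq, ?_, h.active_overlap, ?_, ?_⟩
  · intro a b ha hb hab
    obtain ⟨ha, hat⟩ := hp a ha
    obtain ⟨hb, hbt⟩ := hp b hb
    exact h.primary_unique a b ha hb (by simpa [hat, hbt] using hab)
  · intro p hp'
    obtain ⟨hp', hpt⟩ := hp p hp'
    simpa [hpt] using h.primary_configTerm p hp'
  · intro p a hp'
    exact h.primary_newest p a (hp p hp').1
  · intro a b Q hb hQ
    obtain ⟨n, hn, hle'⟩ := h.active_safe a b Q hb hQ
    exact ⟨n, hn, hle'.trans (hle n)⟩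
  · intro p a Q hp' hpa hQ
    obtain ⟨hp', hpt⟩ := hp p hp'
    have hpt' : Function.update x.term t (x.term s) p = x.term p := by simp [hpt]
    simp only [hpt'] at hpa ⊢
    obtain ⟨n, hn, hlt'⟩ := h.stale_blocked p a Q hp' hpa hQ
    exact ⟨n, hn, hlt'.trans_le (hle n)⟩

/-- A primary with a quorum in its own term has a configuration that is not older than any other. -/
theorem ConfigInv.not_newer {x : State Server} (h : ConfigInv x) {s : Server} {Q : Finset Server}
    (hs : x.state s = Role.primary) (hQ : IsQuorum (x.config s) Q)
    (hterm : ∀ v ∈ Q, x.term v = x.term s) (u : Server) :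
    x.configTerm u ≤ x.term s ∧ ¬ IsNewerConfig x u s := by
  have h1 : x.configTerm u ≤ x.term s := by
    by_contra hlt
    obtain ⟨n, hn, hlt'⟩ := h.stale_blocked s u Q hs (not_le.1 hlt) hQ
    exact hlt'.ne' (hterm n hn)
  refine ⟨h1, ?_⟩
  have h2 := h.primary_configTerm s hs
  have h3 := h.primary_newest s u hs
  grind [IsNewerConfig]

theorem ConfigInv.active_of_quorum {x : State Server} (h : ConfigInv x) {s : Server}
    {Q : Finset Server} (hs : x.state s = Role.primary) (hQ : IsQuorum (x.config s) Q)
    (hterm : ∀ v ∈ Q, x.term v = x.term s) : Active x s :=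
  ⟨Q, hQ, fun n _ => (h.not_newer hs hQ hterm n).2⟩

/-- After a reconfiguration by `s`, any other server whose configuration is active has the
configuration that `s` has just left: the servers passing the quorum check deactivate all older
ones. -/
theorem ConfigInv.active_reconfig {s : Server} {m : Finset Server} {x y : State Server}
    (h : ConfigInv x) (hxy : Reconfig s m x y) {u : Server} (hus : u ≠ s) (hu : Active y u) :
    Active x u ∧ x.config u = x.config s := by
  obtain ⟨hs, ⟨Qc, hQc, hcfg⟩, ⟨Qt, hQt, hterm⟩, -, -, -, rfl⟩ := hxy
  have hnew := h.not_newer hs hQt hterm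
  have hct := h.primary_configTerm s hs
  have hux : Active x u := by
    refine hu.of_newer (by simp [hus]) fun n hn => ?_
    by_cases hns : n = s <;> grind [IsNewerConfig]
  refine ⟨hux, ?_⟩
  obtain ⟨Q, hQ, hQn⟩ := hu
  have hsx := h.active_of_quorum hs hQt hterm
  -- Some server of the quorum that makes `u` active still has the previous configuration of `s`.
  obtain ⟨n, hnc, hnQ⟩ := (h.active_overlap s u hsx hux).exists_mem hQc (by simpa [hus] using hQ)
  have h1 := hQn n hnQ
  have h2 := hcfg n hnc
  have h3 := (hnew u).2
  apply h.config_eq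
  by_cases hns : n = s <;> grind [IsNewerConfig, SameConfig]

theorem ConfigInv.reconfig {s : Server} {m : Finset Server} {x y : State Server} (h : ConfigInv x)
    (hxy : Reconfig s m x y) : ConfigInv y := by
  have hact {u : Server} := h.active_reconfig hxy (u := u)
  obtain ⟨hs, -, ⟨Qt, hQt, hterm⟩, -, hover, -, rfl⟩ := hxy
  have hnew := h.not_newer hs hQt hterm
  have hct := h.primary_configTerm s hs
  have hover' : QuorumsOverlap m (x.config s) := fun Q₁ Q₂ h₁ h₂ => by
    rw [Finset.inter_comm]
    exact hover Q₂ Q₁ h₂ h₁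
  have hcts : Function.update x.configTerm s (x.term s) = x.configTerm := by simp [← hct]
  simp only [hcts] at hact ⊢
  refine ⟨h.primary_unique, h.primary_configTerm, ?_, ?_, ?_, ?_, ?_⟩
  · have := h.config_eq
    intro a b hab
    have h1 := (hnew a).2
    have h2 := (hnew b).2
    by_cases ha : a = s <;> by_cases hb : b = s <;> grind [SameConfig, IsNewerConfig]
  · intro p a hp hap
    have h1 := h.primary_newest p a hp hap
    have h2 := h.primary_unique p s hp hs
    have h3 := h.primary_configTerm p hp
    by_cases ha : a = s <;> by_cases hb : p = s <;> grind
  · intro a b ha hb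
    by_cases has : a = s <;> by_cases hbs : b = s
    · subst has hbs
      exact quorumsOverlap_self _
    · subst has
      simpa [hbs, (hact hbs hb).2] using hover'
    · subst hbs
      simpa [has, (hact has ha).2] using hover
    · simpa [has, hbs] using h.active_overlap a b (hact has ha).1 (hact hbs hb).1
  · intro a b Q hb hQ
    by_cases hbs : b = s
    · subst hbs
      obtain ⟨n, hn, hn'⟩ := hover.exists_mem hQt (by simpa using hQ)
      exact ⟨n, hn', (hnew a).1.trans (hterm n hn).ge⟩
    · exact h.active_safe a b Q (hact hbs hb).1 (by simpa [hbs] using hQ)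
  · intro p a Q hp hpa hQ
    by_cases hps : p = s
    · subst hps
      exact absurd hpa (hnew a).1.not_gt
    · exact h.stale_blocked p a Q hp hpa (by simpa [hps] using hQ)

theorem BecomeLeader.active_self {s : Server} {Q : Finset Server} {x y : State Server}
    (hQ : IsQuorum (x.config s) Q) (hxy : BecomeLeader s Q x y) : Active x s := by
  obtain ⟨-, -, hvote, -⟩ := hxy
  refine ⟨Q, hQ, fun n hn => ?_⟩
  have := (hvote n hn).1.2
  grind [IsNewerConfig, SameConfig]

/-- A server is elected in a term larger than that of any configuration. -/
theorem ConfigInv.configTerm_lt {s : Server} {Q : Finset Server} {x y : State Server}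
    (h : ConfigInv x) (hQ : IsQuorum (x.config s) Q) (hxy : BecomeLeader s Q x y) (u : Server) :
    x.configTerm u < x.term s + 1 := by
  obtain ⟨n, hn, hle⟩ := h.active_safe u s Q (hxy.active_self hQ) hQ
  exact hle.trans_lt (hxy.2.2.1 n hn).1.1

/-- Elections create no new active member sets. -/
theorem ConfigInv.active_becomeLeader {s : Server} {Q : Finset Server} {x y : State Server}
    (h : ConfigInv x) (hQ : IsQuorum (x.config s) Q) (hxy : BecomeLeader s Q x y) {u : Server}
    (hu : Active y u) : Active x u := by
  by_cases hus : u = s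
  · exact hus ▸ hxy.active_self hQ
  have hlt := h.configTerm_lt hQ hxy
  obtain ⟨-, -, -, rfl⟩ := hxy
  refine hu.of_newer rfl fun n hn => ?_
  by_cases hns : n = s <;> grind [IsNewerConfig]

theorem ConfigInv.becomeLeader {s : Server} {Q : Finset Server} {x y : State Server}
    (h : ConfigInv x) (hQ : IsQuorum (x.config s) Q) (hxy : BecomeLeader s Q x y) :
    ConfigInv y := by
  have hlt := h.configTerm_lt hQ hxy
  have hact {u : Server} := h.active_becomeLeader hQ hxy (u := u)
  have hsx := hxy.active_self hQ
  obtain ⟨-, hsQ, hvote, rfl⟩ := hxy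
  have hprim : ∀ p, (if p = s then Role.primary else if p ∈ Q then Role.secondary else x.state p) =
      Role.primary → p = s ∨ (p ≠ s ∧ p ∉ Q ∧ x.state p = Role.primary) := by
    intro p hp
    grind
  have hle : ∀ n, x.term n ≤ if n ∈ Q then x.term s + 1 else x.term n := by
    intro n
    split_ifs with hn
    · exact (hvote n hn).1.1.le
    · exact le_rfl
  refine ⟨?_, ?_, ?_, ?_, ?_, ?_, ?_⟩
  · intro a b ha hb hab
    have h1 := h.primary_unique a b
    have h2 := h.primary_configTerm a
    have h3 := h.primary_configTerm b
    have h4 := hlt a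
    have h5 := hlt b
    have h6 := hprim a ha
    have h7 := hprim b hb
    grind
  · intro p hp
    have h2 := h.primary_configTerm p
    have h6 := hprim p hp
    grind
  · intro a b hab
    have h1 := h.config_eq a b
    have h4 := hlt a
    have h5 := hlt b
    by_cases ha : a = s <;> by_cases hb : b = s <;> grind [SameConfig]
  · intro p a hp hap
    have h1 := h.primary_newest p a
    have h4 := hlt a
    have h5 := hlt p
    have h6 := hprim p hp
    by_cases ha : a = s <;> by_cases hb : p = s <;> grind
  · intro a b ha hb
    exact h.active_overlap a b (hact ha) (hact hb)
  · intro a b Q' hb hQ'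
    by_cases has : a = s
    · subst has
      obtain ⟨n, hn, hn'⟩ := (h.active_overlap a b hsx (hact hb)).exists_mem hQ hQ'
      exact ⟨n, hn', by simp [hn]⟩
    · obtain ⟨n, hn, hle'⟩ := h.active_safe a b Q' (hact hb) hQ'
      exact ⟨n, hn, by simpa [has] using hle'.trans (hle n)⟩
  · intro p a Q' hp hpa hQ'
    rcases hprim p hp with rfl | ⟨hps, hpQ, hp'⟩
    · exfalso
      have h4 := hlt a
      by_cases ha : a = p <;> grind
    have hlt' : x.term p < x.term s + 1 := h.primary_configTerm p hp' ▸ hlt p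
    simp only [hpQ, if_false] at hpa ⊢
    by_cases hpx : Active x p
    · by_cases has : a = s
      · obtain ⟨n, hn, hn'⟩ := (h.active_overlap s p hsx hpx).exists_mem hQ hQ'
        exact ⟨n, hn', by simpa [hn] using hlt'⟩
      · obtain ⟨n, hn, hn'⟩ := h.stale_blocked p a Q' hp' (by simpa [has] using hpa) hQ'
        exact ⟨n, hn, hn'.trans_le (hle n)⟩
    · -- Some server of `Q'` has a newer configuration, which cannot be of the term of `p`.
      have : ∃ n ∈ Q', IsNewerConfig x n p := by
        by_contra hcon
        push Not at hcon
        exact hpx ⟨Q', hQ', hcon⟩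
      obtain ⟨n, hn, hnew⟩ := this
      have h1 := h.primary_newest p n hp'
      have h2 := h.primary_configTerm p hp'
      obtain ⟨k, hk, hk'⟩ := h.stale_blocked p n Q' hp' (by grind [IsNewerConfig]) hQ'
      exact ⟨k, hk, hk'.trans_le (hle k)⟩

/-! ### Preservation of the invariant on logs -/

/-- A secondary may replace its log by an initial segment of some log, provided that it keeps its
committed entries. This covers `GetEntries` and `RollbackEntries`. -/
theorem LogInv.set_log_secondary {x : State Server} (h : LogInv x) {s t : Server} {l : List ℕ}
    {k : ℕ} (hs : x.state s = Role.secondary)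
    (hl : ∀ i e, HasEntry l i e ↔ InLog x i e t ∧ i ≤ k)
    (hc : ∀ i e, (i, e) ∈ x.committed → InLog x i e s → HasEntry l i e) :
    LogInv { x with log := Function.update x.log s l } := by
  set y : State Server := { x with log := Function.update x.log s l } with hy
  have hyl : ∀ u, ∃ u' k, ∀ i e, InLog y i e u ↔ InLog x i e u' ∧ i ≤ k := by
    intro u
    by_cases hus : u = s
    · refine ⟨t, k, fun i e => ?_⟩
      rw [← hl]
      simp [hy, InLog, hus]
    · refine ⟨u, (x.log u).length, fun i e => ?_⟩
      simp only [hy, InLog, Function.update_of_ne hus]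
      exact ⟨fun h' => ⟨h', h'.length_le⟩, And.left⟩
  have hyp : ∀ p, x.state p = Role.primary → ∀ i e, InLog y i e p ↔ InLog x i e p := by
    intro p hp i e
    have hps : p ≠ s := by
      rintro rfl
      simp [hs] at hp
    simp [hy, InLog, hps]
  refine ⟨?_, ?_, ?_, ?_, ?_, ?_, ?_, ?_, ?_⟩
  · intro a b i j e f hia hib hji hja
    obtain ⟨a', ka, ha⟩ := hyl a
    obtain ⟨b', kb, hb⟩ := hyl b
    rw [ha] at hia hja
    rw [hb] at hib ⊢
    exact ⟨h.matching a' b' i j e f hia.1 hib.1 hji hja.1, hji.trans hib.2⟩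
  · intro a i j e f hi hj hij
    obtain ⟨a', ka, ha⟩ := hyl a
    exact h.sorted a' i j e f ((ha _ _).1 hi).1 ((ha _ _).1 hj).1 hij
  · intro a b i j e hia hjb hij
    obtain ⟨a', ka, ha⟩ := hyl a
    obtain ⟨b', kb, hb⟩ := hyl b
    rw [ha] at hia
    rw [hb] at hjb ⊢
    exact ⟨h.uniform a' b' i j e hia.1 hjb.1 hij, hij.trans hjb.2⟩
  · intro p a i hp hi
    obtain ⟨a', ka, ha⟩ := hyl a
    exact (hyp p hp _ _).2 (h.primary_has p a' i hp ((ha _ _).1 hi).1)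
  · intro p i e hp hi
    exact h.primary_bound p i e hp ((hyp p hp _ _).1 hi)
  · intro a i e hi
    obtain ⟨a', ka, ha⟩ := hyl a
    exact h.exists_configTerm a' i e ((ha _ _).1 hi).1
  · intro p i e hp hie hle
    exact (hyp p hp _ _).2 (h.primary_committed p i e hp hie hle)
  · intro a i j e f hie hj hef
    obtain ⟨a', ka, ha⟩ := hyl a
    rw [ha] at hj ⊢
    have hi := h.later_committed a' i j e f hie hj.1 hef
    refine ⟨hi, le_trans ?_ hj.2⟩
    by_contra hlt
    exact hef.not_ge (h.sorted a' j i f e hj.1 hi (not_le.1 hlt).le)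
  · intro a i e Q hie ha hQ
    obtain ⟨n, hn, hin⟩ := h.active_committed a i e Q hie ha hQ
    refine ⟨n, hn, ?_⟩
    by_cases hns : n = s
    · subst hns
      simpa [hy, InLog] using hc i e hie hin
    · simpa [hy, InLog, hns] using hin

theorem LogInv.getEntries {s t : Server} {x y : State Server} (h : LogInv x)
    (hxy : GetEntries s t x y) : LogInv y := by
  obtain ⟨hs, hlast, e, he, rfl⟩ := hxy
  -- The log of `s` is an initial segment of that of `t`, by log matching.
  have hpre : ∀ i f, InLog x i f s ↔ InLog x i f t ∧ i ≤ (x.log s).length := by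
    intro i f
    by_cases hnil : x.log s = []
    · have hi : ¬ InLog x i f s := fun hi => not_hasEntry_nil i f (hnil ▸ hi)
      refine ⟨fun hi' => absurd hi' hi, fun hi' => ?_⟩
      have := hi'.1.1
      have := hi'.2
      simp [hnil] at this
      omega
    · have h1 : InLog x _ _ s := hasEntry_lastTerm hnil
      have h2 := hlast hnil
      exact ⟨fun hi => ⟨h.matching s t _ i _ f h1 h2 hi.length_le hi, hi.length_le⟩,
        fun hi => h.matching t s _ i _ f h2 h1 hi.2 hi.1⟩
  refine h.set_log_secondary (t := t) (k := (x.log s).length + 1) hs (fun i f => ?_)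
    fun i f _ hi => hasEntry_append_singleton.2 (Or.inl hi)
  have h1 := hpre i f
  rw [hasEntry_append_singleton]
  constructor
  · rintro (hi | ⟨rfl, rfl⟩)
    · exact ⟨(h1.1 hi).1, (h1.1 hi).2.trans (Nat.le_succ _)⟩
    · exact ⟨he, le_rfl⟩
  · rintro ⟨hi, hle⟩
    rcases hle.lt_or_eq with hlt | rfl
    · exact Or.inl (h1.2 ⟨hi, Nat.lt_succ_iff.1 hlt⟩)
    · exact Or.inr ⟨rfl, hi.unique he⟩

theorem LogInv.rollbackEntries {s t : Server} {x y : State Server} (h : LogInv x)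
    (hxy : RollbackEntries s t x y) : LogInv y := by
  obtain ⟨hs, ⟨hnil, hlt, hnot⟩, rfl⟩ := hxy
  refine h.set_log_secondary (t := s) (k := (x.log s).length - 1) hs
    (fun i e => hasEntry_dropLast) fun i e hie hi => hasEntry_dropLast.2 ⟨hi, ?_⟩
  by_contra hle
  have hieq : i = (x.log s).length := by
    have := hi.length_le
    omega
  subst hieq
  have hee : e = lastTerm (x.log s) := hi.unique (hasEntry_lastTerm hnil)
  subst hee
  -- The deleted entry would be committed, so that the later log of `t` would contain it.
  have htnil : x.log t ≠ [] := by
    intro h0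
    simp [h0, lastTerm] at hlt
  exact hnot (h.later_committed t _ _ _ _ hie (hasEntry_lastTerm htnil) hlt)

theorem LogInv.clientRequest {s : Server} {x y : State Server} (hC : ConfigInv x) (h : LogInv x)
    (hxy : ClientRequest s x y) : LogInv y := by
  obtain ⟨hs, rfl⟩ := hxy
  set y : State Server :=
    { x with log := Function.update x.log s (x.log s ++ [x.term s]) } with hy
  have hyl : ∀ i e u, InLog y i e u ↔
      InLog x i e u ∨ (u = s ∧ i = (x.log s).length + 1 ∧ e = x.term s) := by
    intro i e u
    by_cases hus : u = s
    · subst hus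
      simp [hy, InLog, hasEntry_append_singleton]
    · simp [hy, InLog, hus]
  have hmono : ∀ i e u, InLog x i e u → InLog y i e u := fun i e u hi => (hyl i e u).2 (Or.inl hi)
  have hlen : ∀ i e, InLog x i e s → i ≤ (x.log s).length := fun i e hi => hi.length_le
  -- By `primary_has`, no log has an entry of the current term of `s` beyond the log of `s`.
  have hown : ∀ u i, InLog x i (x.term s) u → InLog x i (x.term s) s ∧ i ≤ (x.log s).length :=
    fun u i hi => ⟨h.primary_has s u i hs hi, hlen _ _ (h.primary_has s u i hs hi)⟩
  refine ⟨?_, ?_, ?_, ?_, ?_, ?_, ?_, ?_, ?_⟩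
  · intro a b i j e f hia hib hji hja
    have h1 := h.matching a b i j e f
    have h2 := hown a i
    have h3 := hown b i
    have h4 := hlen i
    have h5 := hlen j
    rw [hyl] at hia hib hja ⊢
    grind
  · intro a i j e f hi hj hij
    have h1 := h.sorted a i j e f
    have h2 := h.primary_bound s i e hs
    have h3 := hlen j f
    have h4 := hlen i e
    rw [hyl] at hi hj
    grind
  · intro a b i j e hia hjb hij
    have h1 := h.uniform a b i j e
    have h2 := hown a i
    have h3 := hown b j
    rw [hyl] at hia hjb ⊢
    grind
  · intro p a i hp hi
    have h1 := h.primary_has p a i hp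
    have h2 := hC.primary_unique p s hp hs
    rw [hyl] at hi ⊢
    grind
  · intro p i e hp hi
    have h1 := h.primary_bound p i e hp
    rw [hyl] at hi
    grind
  · intro a i e hi
    rcases (hyl i e a).1 hi with hi | ⟨-, -, rfl⟩
    · exact h.exists_configTerm a i e hi
    · exact ⟨s, (hC.primary_configTerm s hs).ge⟩
  · intro p i e hp hie hle
    exact hmono _ _ _ (h.primary_committed p i e hp hie hle)
  · intro a i j e f hie hj hef
    apply hmono
    rcases (hyl j f a).1 hj with hj | ⟨rfl, -, rfl⟩
    · exact h.later_committed a i j e f hie hj hef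
    · exact h.primary_committed a i e hs hie hef.le
  · intro a i e Q hie ha hQ
    obtain ⟨n, hn, hin⟩ := h.active_committed a i e Q hie ha hQ
    exact ⟨n, hn, hmono _ _ _ hin⟩

theorem LogInv.commitEntry {s : Server} {Q : Finset Server} {x y : State Server}
    (hC : ConfigInv x) (h : LogInv x) (hQ : IsQuorum (x.config s) Q)
    (hxy : CommitEntry s Q x y) : LogInv y := by
  obtain ⟨hs, hnil, hlast, himm, rfl⟩ := hxy
  have hin : InLog x (x.log s).length (x.term s) s := hlast ▸ hasEntry_lastTerm hnil
  have hterm : ∀ v ∈ Q, x.term v = x.term s := fun v hv => (himm v hv).2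
  have hnew := hC.not_newer hs hQ hterm
  refine ⟨h.matching, h.sorted, h.uniform, h.primary_has, h.primary_bound, h.exists_configTerm,
    ?_, ?_, ?_⟩
  · rintro p i e hp (hie | hie) hle
    · obtain ⟨rfl, rfl⟩ := Prod.mk.inj hie
      have hle' := hC.primary_configTerm p hp ▸ (hnew p).1
      obtain rfl := hC.primary_unique p s hp hs (le_antisymm hle' hle)
      exact hin
    · exact h.primary_committed p i e hp hie hle
  · rintro a i j e f (hie | hie) hj hef
    · obtain ⟨rfl, rfl⟩ := Prod.mk.inj hie
      obtain ⟨t, ht⟩ := h.exists_configTerm a j f hj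
      exact absurd (hef.trans_le ht) (hnew t).1.not_gt
    · exact h.later_committed a i j e f hie hj hef
  · rintro a i e Q' (hie | hie) ha hQ'
    · obtain ⟨rfl, rfl⟩ := Prod.mk.inj hie
      obtain ⟨n, hn, hn'⟩ :=
        (hC.active_overlap s a (hC.active_of_quorum hs hQ hterm) ha).exists_mem hQ hQ'
      exact ⟨n, hn', (himm n hn).1⟩
    · exact h.active_committed a i e Q' hie ha hQ'

theorem LogInv.sendConfig {s t : Server} {x y : State Server} (h : LogInv x)
    (hxy : SendConfig s t x y) : LogInv y := by
  have hact := @hxy.active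
  obtain ⟨-, hnew, rfl⟩ := hxy
  refine ⟨h.matching, h.sorted, h.uniform, h.primary_has, h.primary_bound, ?_,
    h.primary_committed, h.later_committed, ?_⟩
  · intro a i e hi
    obtain ⟨u, hu⟩ := h.exists_configTerm a i e hi
    refine ⟨u, hu.trans ?_⟩
    by_cases hut : u = t <;> grind [IsNewerConfig]
  · intro a i e Q hie ha hQ
    obtain ⟨a', ha', hea⟩ := hact ha
    exact h.active_committed a' i e Q hie ha' (hea ▸ hQ)

theorem LogInv.reconfig {s : Server} {m : Finset Server} {x y : State Server} (hC : ConfigInv x)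
    (h : LogInv x) (hxy : Reconfig s m x y) : LogInv y := by
  have hact {u : Server} := hC.active_reconfig hxy (u := u)
  obtain ⟨hs, -, -, hop, hover, -, rfl⟩ := hxy
  refine ⟨h.matching, h.sorted, h.uniform, h.primary_has, h.primary_bound, ?_,
    h.primary_committed, h.later_committed, ?_⟩
  · have hcts : Function.update x.configTerm s (x.term s) = x.configTerm := by
      simp [← hC.primary_configTerm s hs]
    simp only [hcts]
    exact h.exists_configTerm
  · intro a i e Q hie ha hQ
    by_cases has : a = s
    · subst has
      obtain ⟨Qc, hQc, hin⟩ := hop (i, e) hie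
      obtain ⟨n, hn, hn'⟩ := hover.exists_mem hQc (by simpa using hQ)
      exact ⟨n, hn', hin n hn⟩
    · exact h.active_committed a i e Q hie (hact has ha).1 (by simpa [has] using hQ)

theorem LogInv.becomeLeader {s : Server} {Q : Finset Server} {x y : State Server}
    (hC : ConfigInv x) (h : LogInv x) (hQ : IsQuorum (x.config s) Q)
    (hxy : BecomeLeader s Q x y) : LogInv y := by
  have hlt := hC.configTerm_lt hQ hxy
  have hact {u : Server} := hC.active_becomeLeader hQ hxy (u := u)
  have hsx := hxy.active_self hQ
  obtain ⟨-, hsQ, hvote, rfl⟩ := hxy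
  have hprim : ∀ p, (if p = s then Role.primary else if p ∈ Q then Role.secondary else x.state p) =
      Role.primary → p = s ∨ (p ∉ Q ∧ x.state p = Role.primary) := by
    intro p hp
    grind
  have hentry : ∀ u i e, InLog x i e u → e < x.term s + 1 := by
    intro u i e hi
    obtain ⟨t, ht⟩ := h.exists_configTerm u i e hi
    exact ht.trans_lt (hlt t)
  refine ⟨h.matching, h.sorted, h.uniform, ?_, ?_, ?_, ?_, h.later_committed, ?_⟩
  · intro p a i hp hi
    rcases hprim p hp with rfl | ⟨hpQ, hp'⟩
    · simp only [hsQ, if_true] at hi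
      exact absurd (hentry a i _ hi) (lt_irrefl _)
    · simp only [hpQ, if_false] at hi ⊢
      exact h.primary_has p a i hp' hi
  · intro p i e hp hi
    rcases hprim p hp with rfl | ⟨hpQ, hp'⟩
    · simpa [hsQ] using (hentry p i e hi).le
    · simpa [hpQ] using h.primary_bound p i e hp' hi
  · intro a i e hi
    obtain ⟨t, ht⟩ := h.exists_configTerm a i e hi
    refine ⟨t, ht.trans ?_⟩
    have := hlt t
    by_cases hts : t = s <;> grind
  · intro p i e hp hie hle
    rcases hprim p hp with rfl | ⟨hpQ, hp'⟩
    · obtain ⟨n, hn, hin⟩ := h.active_committed p i e Q hie hsx hQ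
      exact h.inLog_of_vote hie hin (hvote n hn).2
    · exact h.primary_committed p i e hp' hie (by simpa [hpQ] using hle)
  · intro a i e Q' hie ha hQ'
    exact h.active_committed a i e Q' hie (hact ha) hQ'

theorem LogInv.updateTerms {s t : Server} {x y : State Server} (h : LogInv x)
    (hxy : UpdateTerms s t x y) : LogInv y := by
  obtain ⟨hlt, rfl⟩ := hxy
  have hp : ∀ p, Function.update x.state t Role.secondary p = Role.primary →
      x.state p = Role.primary ∧ Function.update x.term t (x.term s) p = x.term p := by
    intro p hp
    by_cases hpt : p = t
    · simp [hpt] at hp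
    · exact ⟨by simpa [hpt] using hp, by simp [hpt]⟩
  refine ⟨h.matching, h.sorted, h.uniform, ?_, ?_, h.exists_configTerm, ?_, h.later_committed,
    h.active_committed⟩
  · intro p a i hp' hi
    obtain ⟨hp', hpt⟩ := hp p hp'
    simp only [hpt] at hi ⊢
    exact h.primary_has p a i hp' hi
  · intro p i e hp' hi
    obtain ⟨hp', hpt⟩ := hp p hp'
    simpa only [hpt] using h.primary_bound p i e hp' hi
  · intro p i e hp' hie hle
    obtain ⟨hp', hpt⟩ := hp p hp'
    exact h.primary_committed p i e hp' hie (by simpa only [hpt] using hle)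

/-! ### Reachable states -/

theorem inv_of_next {x y : State Server} (hC : ConfigInv x) (hL : LogInv x) (h : MRRNext x y) :
    ConfigInv y ∧ LogInv y := by
  obtain ⟨s, t, Q, hQ, h | h | h | h | h | ⟨m, h⟩ | h | h⟩ := h
  · refine ⟨?_, hL.clientRequest hC h⟩
    rw [h.2]
    exact hC.set_log_committed _ _
  · refine ⟨?_, hL.getEntries h⟩
    obtain ⟨-, -, e, -, rfl⟩ := h
    exact hC.set_log_committed _ _
  · refine ⟨?_, hL.rollbackEntries h⟩
    rw [h.2.2]
    exact hC.set_log_committed _ _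
  · refine ⟨?_, hL.commitEntry hC hQ h⟩
    rw [h.2.2.2.2]
    exact hC.set_log_committed _ _
  · exact ⟨hC.sendConfig h, hL.sendConfig h⟩
  · exact ⟨hC.reconfig h, hL.reconfig hC h⟩
  · exact ⟨hC.becomeLeader hQ h, hL.becomeLeader hC hQ h⟩
  · exact ⟨hC.updateTerms h, hL.updateTerms h⟩

theorem inv_of_spec {σ : Behavior (State Server)} (h : MRRSpec σ) (n : ℕ) :
    ConfigInv (σ n) ∧ LogInv (σ n) := by
  induction n with
  | zero => exact ⟨.of_init h.1, .of_init h.1⟩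
  | succ n ih =>
    rcases h.2 n with hn | hn
    · exact inv_of_next ih.1 ih.2 hn
    · have hn' : σ (n + 1) = σ n := hn
      rwa [hn']

end MRR

theorem theorem1 (Server : Type*) [Fintype Server] [DecidableEq Server] :
    MRR.Valid (fun σ : MRR.Behavior (MRR.State Server) =>
      MRR.MRRSpec σ → MRR.Always (MRR.StateFormula MRR.LeaderCompleteness) σ) := by
  intro σ h n s i e hie hs
  exact (MRR.inv_of_spec h n).2.primary_committed s i e hs.1 hie hs.2.le
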